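/- Let $\{0,1\}^n$ label the computational basis of $n$ qubits. For $1\le K\le 2^n$ let $\mathcal E_{\mathrm{rsp}}(n,K)$ be the ensemble of random subset phase states with subset dimension $K$, that is, of the states $$|\psi_{S,f}\rangle=\frac1{\sqrt K}\sum_{x\in S}(-1)^{f(x)}|x\rangle ,$$ where $S\subseteq\{0,1\}^n$ is a uniformly random subset of size $K$ and, independently, $f:\{0,1\}^n\to\{0,1\}$ is a uniformly random function. For a pure $n$-qubit state $\psi$ and $\alpha\ge 0$, the stabilizer Rényi entropy is $M_\alpha(\psi)=S_\alpha(\Xi_\psi)-\log_2 2^n$, where $\Xi_\psi(P)=2^{-n}\langle\psi|P|\psi\rangle^2$ is a probability distribution on the $4^n$ Pauli strings $P\in\{I,X,Y,Z\}^{\otimes n}$ and $S_\alpha$ is the Rényi entropy in bits (the Shannon entropy for $\alpha=1$, the logarithm of the size of the support for $\alpha=0$). The relative entropy of coherence is $C_{\mathrm{rel.ent.}}(\rho)=S(\rho_{\mathrm{diag}})-S(\rho)$, where $S$ is the von Neumann entropy in bits and $\rho_{\mathrm{diag}}$ is $\rho$ with its off-diagonal entries removed. Suppose that $K=2^{\Theta(\log(t/\epsilon))}$.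 Precisely, fix constants $0<c_1\le c_2$; below, $n,t,K$ range over the natural numbers and $\epsilon$ over the reals with $t\ge1$, $0<\epsilon\le 1$, $K\le 2^n$ and $$2^{c_1\log_2(t/\epsilon)}\le K\le 2^{c_2\log_2(t/\epsilon)}.$$ (1) For every constant $\alpha\ge0$, $\mathbb E_{\psi\sim\mathcal E_{\mathrm{rsp}}(n,K)}[M_\alpha(\psi)]=\Theta(\log(t/\epsilon))$. Precisely, there are constants $a,b>0$ and $R$, depending only on $\alpha,c_1,c_2$, such that for all such $n,t,K,\epsilon$ $$\mathbb E_{\psi\sim\mathcal E_{\mathrm{rsp}}(n,K)}[M_\alpha(\psi)]\le b\log_2(t/\epsilon),$$ and, whenever $t/\epsilon\ge R$, $$a\log_2(t/\epsilon)\le \mathbb E_{\psi\sim\mathcal E_{\mathrm{rsp}}(n,K)}[M_\alpha(\psi)].$$ (2) $\mathbb E_{\psi\sim\mathcal E_{\mathrm{rsp}}(n,K)}[C_{\mathrm{rel.ent.}}(|\psi\rangle\langle\psi|)]=\Omega(\log(t/\epsilon))$. Precisely, there is a constant $d>0$, depending only on $c_1,c_2$, such that for all such $n,t,K,\epsilon$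 $$\mathbb E_{\psi\sim\mathcal E_{\mathrm{rsp}}(n,K)}[C_{\mathrm{rel.ent.}}(|\psi\rangle\langle\psi|)]\ge d\,\log_2(t/\epsilon).$$ -/

import Mathlib

open scoped BigOperators Matrix

noncomputable section

/-- Bit strings of length `n`; they label the computational basis of `n` qubits. -/
abbrev BitString (n : ℕ) : Type := Fin n → Fin 2

/-- The amplitudes, in the computational basis, of a vector of the `n`-qubit space. -/
abbrev QubitVector (n : ℕ) : Type := BitString n → ℂ

/-- The four single-qubit Pauli matrices `I, X, Y, Z`. -/
def pauliMatrix : Fin 4 → Matrix (Fin 2) (Fin 2) ℂ :=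
  ![1, !![0, 1; 1, 0], !![0, -Complex.I; Complex.I, 0], !![1, 0; 0, -1]]

/-- The `n`-qubit Pauli operator `P 0 ⊗ ⋯ ⊗ P (n - 1)`. The strings `P` enumerate the `4 ^ n`
elements of the `n`-qubit Pauli group modulo phases. -/
def pauliString {n : ℕ} (P : Fin n → Fin 4) : Matrix (BitString n) (BitString n) ℂ :=
  Matrix.of fun x y => ∏ i, pauliMatrix (P i) (x i) (y i)

/-- The expectation value `⟨ψ|P|ψ⟩`, which is real because `P` is Hermitian. -/
def pauliExpectation {n : ℕ} (ψ : QubitVector n) (P : Fin n → Fin 4) : ℝ :=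
  (star ψ ⬝ᵥ (pauliString P *ᵥ ψ)).re

/-- The Pauli distribution `Ξ_ψ(P) = 2⁻ⁿ ⟨ψ|P|ψ⟩²`. -/
def pauliDistribution {n : ℕ} (ψ : QubitVector n) (P : Fin n → Fin 4) : ℝ :=
  (2 ^ n : ℝ)⁻¹ * pauliExpectation ψ P ^ 2

/-- The Rényi entropy (in bits) of order `α ≥ 0` of a finite distribution: the Shannon entropy for
`α = 1`; for `α = 0` it is the logarithm of the size of the support. -/
def renyiEntropy {ι : Type*} [Fintype ι] (α : ℝ) (p : ι → ℝ) : ℝ :=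
  open Classical in
  if α = 1 then -∑ i, p i * Real.logb 2 (p i)
  else (1 / (1 - α)) * Real.logb 2 (∑ i with p i ≠ 0, p i ^ α)

/-- The stabilizer Rényi entropy `M_α(ψ) = S_α(Ξ_ψ) - log 2ⁿ`. -/
def stabilizerRenyiEntropy {n : ℕ} (α : ℝ) (ψ : QubitVector n) : ℝ :=
  renyiEntropy α (pauliDistribution ψ) - Real.logb 2 (2 ^ n)

/-- The von Neumann entropy (in bits) of a Hermitian matrix, `-∑ λ log λ` over its eigenvalues. -/
def vonNeumannEntropy {ι : Type*} [Fintype ι] [DecidableEq ι] {ρ : Matrix ι ι ℂ}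
    (hρ : ρ.IsHermitian) : ℝ :=
  -∑ i, hρ.eigenvalues i * Real.logb 2 (hρ.eigenvalues i)

theorem isHermitian_diagonal_diag {ι : Type*} [DecidableEq ι] {ρ : Matrix ι ι ℂ}
    (hρ : ρ.IsHermitian) : (Matrix.diagonal ρ.diag).IsHermitian := by
  refine Matrix.isHermitian_diagonal_of_self_adjoint _ ?_
  ext i
  exact hρ.apply i i

/-- The relative entropy of coherence `S(ρ_diag) - S(ρ)`. -/
def relEntropyCoherence {ι : Type*} [Fintype ι] [DecidableEq ι] {ρ : Matrix ι ι ℂ}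
    (hρ : ρ.IsHermitian) : ℝ :=
  vonNeumannEntropy (isHermitian_diagonal_diag hρ) - vonNeumannEntropy hρ

/-- The matrix `|ψ⟩⟨ψ|`. -/
def pureDensity {n : ℕ} (ψ : QubitVector n) : Matrix (BitString n) (BitString n) ℂ :=
  Matrix.vecMulVec ψ (star ψ)

theorem pureDensity_isHermitian {n : ℕ} (ψ : QubitVector n) : (pureDensity ψ).IsHermitian := by
  ext i j
  simp [pureDensity, Matrix.vecMulVec_apply, mul_comm]

/-- The relative entropy of coherence of the pure state `|ψ⟩⟨ψ|`. -/
def pureCoherence {n : ℕ} (ψ : QubitVector n) : ℝ :=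
  relEntropyCoherence (pureDensity_isHermitian ψ)

/-- The subset phase state `|S|^(-1/2) ∑_{x ∈ S} (-1)^(f x) |x⟩`. -/
def subsetPhaseState {n : ℕ} (S : Finset (BitString n)) (f : BitString n → Fin 2) :
    QubitVector n :=
  fun x => if x ∈ S then (-1 : ℂ) ^ (f x : ℕ) / (Real.sqrt (S.card : ℝ) : ℂ) else 0

/-- The expectation of `F ψ` when `ψ` is a random `n`-qubit subset phase state of subset
dimension `K`: the subset `S` is uniform among the subsets of size `K`, and the phase function `f`
is uniform among all Boolean functions, independently of `S`. -/
def rspExpectation (n K : ℕ) (F : QubitVector n → ℝ) : ℝ :=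
  (∑ S ∈ Finset.powersetCard K (Finset.univ : Finset (BitString n)),
      ∑ f : BitString n → Fin 2, F (subsetPhaseState S f)) /
    ((Finset.powersetCard K (Finset.univ : Finset (BitString n))).card *
      Fintype.card (BitString n → Fin 2))

end

/-!
The Rényi entropy of order `α` is minus the slope from `1` to `α` of the convex function
`α ↦ log ∑ pᵢ ^ α`, hence decreasing in `α`. For a state supported on `S`, the Pauli string
`X ^ a Z ^ b` has nonzero expectation only if `a ∈ S + S`, so the order-zero entropy gives
`M_α ≤ 2 log |S|`. In the other direction `M_2` bounds `M_α` from below up to a factor depending on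
`α`: this is monotonicity for `α ≤ 2`, and `Ξ_ψ ≤ 2⁻ⁿ` for `α > 2`. By Jensen's inequality it
remains to bound the mean of the stabilizer purity `2 ^ (-M_2)`. Applying Parseval twice writes the
purity as a sum over quadruples of points of `S`. Averaging over the phases kills every quadruple
that is affinely independent over the field with two elements; there are at most `7 |S| ^ 3` others,
each contributing at most `|S| ^ (-4)`, so the mean purity is at most `7 / |S|`.

The coherence of a subset phase state is exactly `log |S|`, since its density matrix is a projection
whose diagonal is uniform on `S`.
-/

open scoped ComplexConjugate

section Renyi

variable {ι : Type*} [Fintype ι] {p : ι → ℝ}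

open Classical in
/-- The power sum `∑ pᵢ ^ α` over the support of `p`, which determines the Rényi entropy of every
order `α ≠ 1`. The restriction to the support matters only for `α = 0`, where `0 ^ 0 = 1`. -/
noncomputable def powerSum (p : ι → ℝ) (α : ℝ) : ℝ :=
  ∑ i with p i ≠ 0, p i ^ α

theorem renyiEntropy_of_ne_one (p : ι → ℝ) {α : ℝ} (hα : α ≠ 1) :
    renyiEntropy α p = 1 / (1 - α) * Real.logb 2 (powerSum p α) :=
  if_neg hα

theorem renyiEntropy_one (p : ι → ℝ) : renyiEntropy 1 p = -∑ i, p i * Real.logb 2 (p i) :=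
  if_pos rfl

theorem powerSum_zero (p : ι → ℝ) : powerSum p 0 = (Function.support p).ncard := by
  classical
  simp [powerSum, Function.support, Set.ncard_eq_toFinset_card']

theorem powerSum_of_ne_zero (p : ι → ℝ) {α : ℝ} (hα : α ≠ 0) : powerSum p α = ∑ i, p i ^ α := by
  classical
  refine Finset.sum_filter_of_ne fun i _ h hi => h ?_
  rw [hi, Real.zero_rpow hα]

theorem powerSum_one (hp : p ∈ stdSimplex ℝ ι) : powerSum p 1 = 1 := by
  simpa [powerSum_of_ne_zero] using hp.2

theorem powerSum_two (p : ι → ℝ) : powerSum p 2 = ∑ i, p i ^ 2 := by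
  simp [powerSum_of_ne_zero]

theorem powerSum_pos (hp : p ∈ stdSimplex ℝ ι) (α : ℝ) : 0 < powerSum p α := by
  classical
  obtain ⟨i, -, hi⟩ := Finset.exists_ne_zero_of_sum_ne_zero (hp.2 ▸ one_ne_zero)
  refine Finset.sum_pos (fun j hj => ?_) ⟨i, by simpa using hi⟩
  exact Real.rpow_pos_of_pos ((hp.1 j).lt_of_ne' (Finset.mem_filter.1 hj).2) α

theorem convexOn_logb_powerSum (hp : p ∈ stdSimplex ℝ ι) :
    ConvexOn ℝ Set.univ fun α => Real.logb 2 (powerSum p α) := by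
  classical
  refine convexOn_iff_forall_pos.2 ⟨convex_univ, fun x _ y _ a b ha hb hab => ?_⟩
  have holder : powerSum p (a * x + b * y) ≤ powerSum p x ^ a * powerSum p y ^ b := by
    have h := Real.inner_le_Lp_mul_Lq_of_nonneg (s := {i | p i ≠ 0}) (f := fun i => (p i ^ x) ^ a)
      (g := fun i => (p i ^ y) ^ b) (Real.HolderConjugate.inv_inv ha hb hab)
      (fun i _ => by have := hp.1 i; positivity) (fun i _ => by have := hp.1 i; positivity)
    simp only [one_div, inv_inv] at h
    convert h using 2
    · refine Finset.sum_congr rfl fun i hi => ?_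
      have hi : 0 < p i := (hp.1 i).lt_of_ne' (Finset.mem_filter.1 hi).2
      rw [← Real.rpow_mul hi.le, ← Real.rpow_mul hi.le, ← Real.rpow_add hi]
      ring_nf
    · refine congrArg (· ^ a) (Finset.sum_congr rfl fun i _ => ?_)
      rw [Real.rpow_rpow_inv (Real.rpow_nonneg (hp.1 i) x) ha.ne']
    · refine congrArg (· ^ b) (Finset.sum_congr rfl fun i _ => ?_)
      rw [Real.rpow_rpow_inv (Real.rpow_nonneg (hp.1 i) y) hb.ne']
  have hx := powerSum_pos hp x
  have hy := powerSum_pos hp y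
  calc Real.logb 2 (powerSum p (a * x + b * y))
      ≤ Real.logb 2 (powerSum p x ^ a * powerSum p y ^ b) :=
        Real.logb_le_logb_of_le one_lt_two (powerSum_pos hp _) holder
    _ = a * Real.logb 2 (powerSum p x) + b * Real.logb 2 (powerSum p y) := by
        rw [Real.logb_mul (by positivity) (by positivity), Real.logb_rpow_eq_mul_logb_of_pos hx,
          Real.logb_rpow_eq_mul_logb_of_pos hy]

theorem renyiEntropy_eq_neg_slope (hp : p ∈ stdSimplex ℝ ι) {α : ℝ} (hα : α ≠ 1) :
    renyiEntropy α p = -slope (fun β => Real.logb 2 (powerSum p β)) 1 α := by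
  rw [renyiEntropy_of_ne_one p hα, slope_def_field, powerSum_one hp, Real.logb_one, sub_zero,
    ← neg_sub α 1, one_div, inv_neg, div_eq_inv_mul, neg_mul]

theorem hasDerivAt_logb_powerSum_one (hp : p ∈ stdSimplex ℝ ι) :
    HasDerivAt (fun α => Real.logb 2 (powerSum p α)) (-renyiEntropy 1 p) 1 := by
  classical
  have hsum : HasDerivAt (powerSum p) (∑ i with p i ≠ 0, p i ^ (1 : ℝ) * Real.log (p i)) 1 :=
    HasDerivAt.fun_sum fun i hi =>
      (Real.hasStrictDerivAt_const_rpow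
        ((hp.1 i).lt_of_ne' (Finset.mem_filter.1 hi).2) 1).hasDerivAt
  refine ((hsum.log (powerSum_pos hp 1).ne').div_const (Real.log 2)).congr_deriv ?_
  rw [renyiEntropy_one, neg_neg, powerSum_one hp, div_one, Finset.sum_div, Finset.sum_filter]
  refine Finset.sum_congr rfl fun i _ => ?_
  by_cases hi : p i = 0 <;> simp [hi, Real.logb, mul_div_assoc]

theorem renyiEntropy_antitone (hp : p ∈ stdSimplex ℝ ι) : Antitone fun α => renyiEntropy α p := by
  intro α β hαβ
  have hconv := convexOn_logb_powerSum hp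
  have hderiv := hasDerivAt_logb_powerSum_one hp
  rcases hαβ.eq_or_lt with rfl | hlt
  · rfl
  rcases eq_or_ne α 1 with rfl | hα
  · have h := hconv.le_slope_of_hasDerivAt trivial trivial hlt hderiv
    simp only [renyiEntropy_eq_neg_slope hp hlt.ne']
    linarith
  rcases eq_or_ne β 1 with rfl | hβ
  · have h := hconv.slope_le_of_hasDerivAt trivial trivial hlt hderiv
    simp only [renyiEntropy_eq_neg_slope hp hα]
    rw [slope_comm] at h
    linarith
  · simp only [renyiEntropy_eq_neg_slope hp hα, renyiEntropy_eq_neg_slope hp hβ]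
    exact neg_le_neg (hconv.slope_mono trivial ⟨trivial, hα⟩ ⟨trivial, hβ⟩ hαβ)

theorem renyiEntropy_zero (p : ι → ℝ) :
    renyiEntropy 0 p = Real.logb 2 (Function.support p).ncard := by
  rw [renyiEntropy_of_ne_one p zero_ne_one, powerSum_zero]
  simp

theorem renyiEntropy_two (p : ι → ℝ) : renyiEntropy 2 p = -Real.logb 2 (∑ i, p i ^ 2) := by
  rw [renyiEntropy_of_ne_one p (by norm_num), powerSum_two]
  norm_num

theorem renyiEntropy_two_add_le (hp : p ∈ stdSimplex ℝ ι) {m : ℝ} (hm : ∀ i, p i ≤ m) {α : ℝ}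
    (hα : 2 ≤ α) :
    renyiEntropy 2 p + (α - 2) * -Real.logb 2 m ≤ (α - 1) * renyiEntropy α p := by
  have hm0 : 0 < m := by
    obtain ⟨i, -, hi⟩ := Finset.exists_ne_zero_of_sum_ne_zero (hp.2 ▸ one_ne_zero)
    exact ((hp.1 i).lt_of_ne' hi).trans_le (hm i)
  have hle : powerSum p α ≤ m ^ (α - 2) * powerSum p 2 := by
    rw [powerSum_of_ne_zero p (by linarith), powerSum_of_ne_zero p two_ne_zero, Finset.mul_sum]
    refine Finset.sum_le_sum fun i _ => ?_
    calc p i ^ α = p i ^ (α - 2) * p i ^ (2 : ℝ) := by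
          rw [← Real.rpow_add_of_nonneg (hp.1 i) (by linarith) zero_le_two, sub_add_cancel]
      _ ≤ m ^ (α - 2) * p i ^ (2 : ℝ) := by
          have := hp.1 i
          gcongr
          exact hm i
  have hlog := Real.logb_le_logb_of_le one_lt_two (powerSum_pos hp α) hle
  rw [Real.logb_mul (by positivity) (powerSum_pos hp 2).ne', Real.logb_rpow_eq_mul_logb_of_pos hm0,
    powerSum_two] at hlog
  have hα' : (α - 1) * (1 / (1 - α)) = -1 := by
    rw [← neg_sub 1 α, neg_mul, mul_one_div_cancel (by linarith)]
  rw [renyiEntropy_two, renyiEntropy_of_ne_one p (by linarith : α ≠ 1), ← mul_assoc, hα']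
  linarith

end Renyi

open Finset in
theorem expect_logb_le_logb_expect {ι : Type*} {s : Finset ι} (hs : s.Nonempty) {W : ι → ℝ}
    (hW : ∀ i ∈ s, 0 < W i) {b : ℝ} (hb : 1 < b) :
    𝔼 i ∈ s, Real.logb b (W i) ≤ Real.logb b (𝔼 i ∈ s, W i) := by
  have hcard : (#s : ℝ) ≠ 0 := by exact_mod_cast hs.card_ne_zero
  have h := strictConcaveOn_log_Ioi.concaveOn.le_map_sum (t := s) (w := fun _ => (#s : ℝ)⁻¹)
    (p := W) (fun _ _ => by positivity) (by simp [hcard]) hW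
  simp only [smul_eq_mul, ← div_eq_inv_mul, ← sum_div, ← expect_eq_sum_div_card] at h
  simp only [Real.logb, ← expect_div]
  have := Real.log_pos hb
  gcongr

section Coherence

variable {ι : Type*} [Fintype ι] [DecidableEq ι]

theorem vonNeumannEntropy_eq_zero_of_isIdempotentElem {ρ : Matrix ι ι ℂ} (hρ : ρ.IsHermitian)
    (hidem : IsIdempotentElem ρ) : vonNeumannEntropy hρ = 0 := by
  refine neg_eq_zero.2 (Finset.sum_eq_zero fun i _ => ?_)
  rcases hidem.spectrum_subset ℝ (hρ.eigenvalues_mem_spectrum_real i) with h | h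
  · rw [h, zero_mul]
  · rw [h, Real.logb_one, mul_zero]

theorem vonNeumannEntropy_diagonal {d : ι → ℂ} (hd : (Matrix.diagonal d).IsHermitian) :
    vonNeumannEntropy hd = -∑ i, (d i).re * Real.logb 2 (d i).re := by
  have eigenvalues_eq : Finset.univ.val.map (RCLike.ofReal ∘ hd.eigenvalues) =
      Finset.univ.val.map d := by
    rw [← hd.roots_charpoly_eq_eigenvalues, Matrix.charpoly_diagonal]
    have h := Polynomial.roots_multiset_prod_X_sub_C (Finset.univ.val.map d)
    rwa [Multiset.map_map] at h
  have h := congrArg (Multiset.map fun z : ℂ => z.re * Real.logb 2 z.re) eigenvalues_eq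
  simp only [Multiset.map_map] at h
  exact congrArg (fun m => -Multiset.sum m) h

theorem pureCoherence_eq {n : ℕ} {ψ : QubitVector n} (hψ : ∑ x, ‖ψ x‖ ^ 2 = 1) :
    pureCoherence ψ = -∑ x, ‖ψ x‖ ^ 2 * Real.logb 2 (‖ψ x‖ ^ 2) := by
  have norm_sq : star ψ ⬝ᵥ ψ = 1 := by
    simp only [dotProduct, Pi.star_apply, Complex.star_def, Complex.conj_mul']
    exact_mod_cast hψ
  have hidem : IsIdempotentElem (pureDensity ψ) := by
    rw [IsIdempotentElem, pureDensity, Matrix.vecMulVec_mul_vecMulVec, norm_sq, one_smul]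
  rw [pureCoherence, relEntropyCoherence, vonNeumannEntropy_diagonal,
    vonNeumannEntropy_eq_zero_of_isIdempotentElem _ hidem, sub_zero]
  have diag_re (x : BitString n) : ((pureDensity ψ).diag x).re = ‖ψ x‖ ^ 2 := by
    rw [Matrix.diag_apply, pureDensity, Matrix.vecMulVec_apply, Pi.star_apply, Complex.star_def,
      Complex.mul_conj', ← Complex.ofReal_pow, Complex.ofReal_re]
  simp only [diag_re]

end Coherence

section Walsh

variable {n : ℕ}

theorem BitString.add_self (x : BitString n) : x + x = 0 :=
  funext fun i => (by decide : ∀ a : Fin 2, a + a = 0) (x i)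

theorem BitString.add_add_cancel (x y : BitString n) : x + (x + y) = y := by
  rw [← add_assoc, add_self, zero_add]

theorem BitString.add_eq_zero_iff {x y : BitString n} : x + y = 0 ↔ x = y := by
  rw [← add_right_inj x, add_add_cancel, add_zero, eq_comm]

/-- The character `x ↦ (-1) ^ (b · x)` of the group of bit strings. -/
def walshCharacter (b x : BitString n) : ℂ := ∏ i, (-1) ^ ((b i : ℕ) * (x i : ℕ))

theorem walshCharacter_add (b x y : BitString n) :
    walshCharacter b (x + y) = walshCharacter b x * walshCharacter b y := by
  have h (a c d : Fin 2) :
      (-1 : ℂ) ^ ((a : ℕ) * ((c + d : Fin 2) : ℕ)) =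
        (-1) ^ ((a : ℕ) * (c : ℕ)) * (-1) ^ ((a : ℕ) * (d : ℕ)) := by
    fin_cases a <;> fin_cases c <;> fin_cases d <;> simp
  simp only [walshCharacter, Pi.add_apply, h, Finset.prod_mul_distrib]

theorem conj_walshCharacter (b x : BitString n) :
    conj (walshCharacter b x) = walshCharacter b x := by
  simp [walshCharacter]

theorem norm_walshCharacter (b x : BitString n) : ‖walshCharacter b x‖ = 1 := by
  simp [walshCharacter, norm_prod]

theorem sum_walshCharacter (x : BitString n) :
    ∑ b, walshCharacter b x = if x = 0 then 2 ^ n else 0 := by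
  have bit_sum (c : Fin 2) :
      ∑ a : Fin 2, (-1 : ℂ) ^ ((a : ℕ) * (c : ℕ)) = if c = 0 then 2 else 0 := by
    fin_cases c <;> norm_num [Fin.sum_univ_two]
  have hprod : ∑ b, walshCharacter b x = ∏ i, if x i = 0 then (2 : ℂ) else 0 := by
    simp only [walshCharacter, ← bit_sum]
    rw [Finset.prod_univ_sum, Fintype.piFinset_univ]
  rw [hprod]
  split_ifs with hx
  · simp [hx]
  · obtain ⟨i, hi⟩ := Function.ne_iff.1 hx
    exact Finset.prod_eq_zero (Finset.mem_univ i) (if_neg hi)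

/-- The Fourier transform of a function on bit strings, without normalization. -/
def walshTransform (g : BitString n → ℂ) (b : BitString n) : ℂ := ∑ x, g x * walshCharacter b x

theorem norm_walshTransform_le (g : BitString n → ℂ) (b : BitString n) :
    ‖walshTransform g b‖ ≤ ∑ x, ‖g x‖ := by
  refine (norm_sum_le _ _).trans_eq ?_
  simp only [norm_mul, norm_walshCharacter, mul_one]

theorem sum_norm_walshTransform_sq (g : BitString n → ℂ) :
    ∑ b, ‖walshTransform g b‖ ^ 2 = 2 ^ n * ∑ x, ‖g x‖ ^ 2 := by
  have expand (b : BitString n) : walshTransform g b * conj (walshTransform g b) =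
      ∑ x, ∑ y, g x * conj (g y) * walshCharacter b (x + y) := by
    simp only [walshTransform, map_sum, map_mul, conj_walshCharacter, Finset.sum_mul_sum,
      walshCharacter_add]
    exact Finset.sum_congr rfl fun x _ => Finset.sum_congr rfl fun y _ => by ring
  have h : ∑ b, walshTransform g b * conj (walshTransform g b) = 2 ^ n * ∑ x, g x * conj (g x) :=
    calc ∑ b, walshTransform g b * conj (walshTransform g b)
      _ = ∑ x, ∑ y, g x * conj (g y) * ∑ b, walshCharacter b (x + y) := by
        simp only [expand, Finset.mul_sum]
        rw [Finset.sum_comm]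
        exact Finset.sum_congr rfl fun x _ => Finset.sum_comm
      _ = 2 ^ n * ∑ x, g x * conj (g x) := by
        simp only [sum_walshCharacter, BitString.add_eq_zero_iff, mul_ite, mul_zero,
          Finset.sum_ite_eq, Finset.mem_univ, if_true, ← Finset.sum_mul, mul_comm (2 ^ n : ℂ)]
  simp only [Complex.mul_conj'] at h
  exact_mod_cast h

theorem walshTransform_sq (g : BitString n → ℂ) (b : BitString n) :
    walshTransform g b ^ 2 = walshTransform (fun s => ∑ x, g x * g (x + s)) b := by
  calc walshTransform g b ^ 2
      = ∑ x, ∑ y, g x * g y * walshCharacter b (x + y) := by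
        simp only [walshTransform, sq, Finset.sum_mul_sum, walshCharacter_add]
        exact Finset.sum_congr rfl fun x _ => Finset.sum_congr rfl fun y _ => by ring
    _ = ∑ x, ∑ s, g x * g (x + s) * walshCharacter b s := by
        refine Finset.sum_congr rfl fun x _ => ?_
        rw [← Equiv.sum_comp (Equiv.addLeft x)]
        simp only [Equiv.coe_addLeft, BitString.add_add_cancel]
    _ = walshTransform (fun s => ∑ x, g x * g (x + s)) b := by
        simp only [walshTransform, Finset.sum_mul]
        exact Finset.sum_comm

theorem sum_norm_walshTransform_pow_four (g : BitString n → ℂ) :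
    ∑ b, ‖walshTransform g b‖ ^ 4 = 2 ^ n * ∑ s, ‖∑ x, g x * g (x + s)‖ ^ 2 := by
  rw [← sum_norm_walshTransform_sq]
  refine Finset.sum_congr rfl fun b _ => ?_
  rw [← walshTransform_sq, norm_pow, ← pow_mul]

end Walsh

section Pauli

variable {n : ℕ}

/-- Single-qubit Pauli matrices are labelled by a bit-flip bit and a phase-flip bit. -/
def pauliBits : Fin 4 ≃ Fin 2 × Fin 2 where
  toFun := ![(0, 0), (1, 0), (1, 1), (0, 1)]
  invFun a := ![![0, 3], ![1, 2]] a.1 a.2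
  left_inv := by decide
  right_inv := by decide

/-- Pauli strings are labelled by a bit-flip string `a` and a phase-flip string `b`: up to a phase
they are `X ^ a Z ^ b`. -/
def pauliStringBits (n : ℕ) : (Fin n → Fin 4) ≃ BitString n × BitString n :=
  (Equiv.arrowCongr (Equiv.refl _) pauliBits).trans (Equiv.arrowProdEquivProdArrow _ _ _)

/-- The phase of a Pauli matrix relative to `X ^ a Z ^ b`; it is nontrivial only for `Y = i X Z`. -/
def pauliPhase : Fin 4 → ℂ := ![1, 1, Complex.I, 1]

theorem pauliMatrix_apply (p : Fin 4) (x y : Fin 2) :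
    pauliMatrix p x y = pauliPhase p *
      if x = y + (pauliBits p).1 then (-1 : ℂ) ^ (((pauliBits p).2 : ℕ) * (y : ℕ)) else 0 := by
  fin_cases p <;> fin_cases x <;> fin_cases y <;> simp [pauliMatrix, pauliPhase, pauliBits]

theorem pauliString_apply (P : Fin n → Fin 4) (x y : BitString n) :
    pauliString P x y = (∏ i, pauliPhase (P i)) *
      if x = y + (pauliStringBits n P).1 then walshCharacter (pauliStringBits n P).2 y else 0 := by
  simp only [pauliString, Matrix.of_apply, pauliMatrix_apply, Finset.prod_mul_distrib]
  congr 1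
  split_ifs with h
  · exact Finset.prod_congr rfl fun i _ => if_pos (congrFun h i)
  · obtain ⟨i, hi⟩ := Function.ne_iff.1 h
    exact Finset.prod_eq_zero (Finset.mem_univ i) (if_neg hi)

theorem pauliString_isHermitian (P : Fin n → Fin 4) : (pauliString P).IsHermitian := by
  have h (p : Fin 4) (x y : Fin 2) : star (pauliMatrix p x y) = pauliMatrix p y x := by
    fin_cases p <;> fin_cases x <;> fin_cases y <;> simp [pauliMatrix]
  ext x y
  simp only [pauliString, Matrix.conjTranspose_apply, Matrix.of_apply, star_prod, h]

theorem norm_prod_pauliPhase (P : Fin n → Fin 4) : ‖∏ i, pauliPhase (P i)‖ = 1 := by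
  have h (p : Fin 4) : ‖pauliPhase p‖ = 1 := by fin_cases p <;> simp [pauliPhase]
  simp only [norm_prod, h, Finset.prod_const_one]

/-- The autocorrelation of `ψ` at shift `a`, whose Walsh transform gives the expectations of the
Pauli strings with bit-flip string `a`. -/
def overlap (ψ : QubitVector n) (a x : BitString n) : ℂ := conj (ψ (x + a)) * ψ x

theorem dotProduct_pauliString_mulVec (ψ : QubitVector n) (P : Fin n → Fin 4) :
    star ψ ⬝ᵥ (pauliString P *ᵥ ψ) = (∏ i, pauliPhase (P i)) *
      walshTransform (overlap ψ (pauliStringBits n P).1) (pauliStringBits n P).2 := by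
  simp only [dotProduct, Matrix.mulVec, pauliString_apply, walshTransform, Finset.mul_sum]
  rw [Finset.sum_comm]
  refine Finset.sum_congr rfl fun y _ => ?_
  rw [Finset.sum_eq_single_of_mem _ (Finset.mem_univ (y + (pauliStringBits n P).1))
    fun x _ hx => by rw [if_neg hx, mul_zero, zero_mul, mul_zero], if_pos rfl]
  simp only [Pi.star_apply, Complex.star_def, overlap]
  ring

theorem abs_pauliExpectation (ψ : QubitVector n) (P : Fin n → Fin 4) :
    |pauliExpectation ψ P| =
      ‖walshTransform (overlap ψ (pauliStringBits n P).1) (pauliStringBits n P).2‖ := by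
  have him : (star ψ ⬝ᵥ (pauliString P *ᵥ ψ)).im = 0 :=
    (pauliString_isHermitian P).im_star_dotProduct_mulVec_self ψ
  rw [pauliExpectation, Complex.abs_re_eq_norm.2 him, dotProduct_pauliString_mulVec, norm_mul,
    norm_prod_pauliPhase, one_mul]

theorem sum_pauliExpectation_sq (ψ : QubitVector n) :
    ∑ P, pauliExpectation ψ P ^ 2 = 2 ^ n * ∑ a, ∑ x, ‖overlap ψ a x‖ ^ 2 := by
  rw [Finset.mul_sum]
  simp only [← sum_norm_walshTransform_sq, ← Fintype.sum_prod_type']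
  refine Fintype.sum_equiv (pauliStringBits n) _ _ fun P => ?_
  rw [← sq_abs, abs_pauliExpectation]

theorem sum_pauliExpectation_pow_four (ψ : QubitVector n) :
    ∑ P, pauliExpectation ψ P ^ 4 =
      2 ^ n * ∑ a, ∑ s, ‖∑ x, overlap ψ a x * overlap ψ a (x + s)‖ ^ 2 := by
  rw [Finset.mul_sum]
  simp only [← sum_norm_walshTransform_pow_four, ← Fintype.sum_prod_type']
  refine Fintype.sum_equiv (pauliStringBits n) _ _ fun P => ?_
  rw [← Even.pow_abs (by decide), abs_pauliExpectation]

theorem sum_norm_overlap_sq (ψ : QubitVector n) :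
    ∑ a, ∑ x, ‖overlap ψ a x‖ ^ 2 = (∑ x, ‖ψ x‖ ^ 2) ^ 2 := by
  rw [Finset.sum_comm, sq, Finset.sum_mul_sum]
  refine Finset.sum_congr rfl fun x _ => ?_
  rw [← Equiv.sum_comp (Equiv.addLeft x)]
  simp only [overlap, Equiv.coe_addLeft, BitString.add_add_cancel, norm_mul, RCLike.norm_conj,
    mul_pow, mul_comm]

end Pauli

section StabilizerEntropy

variable {n : ℕ} {ψ : QubitVector n}

theorem pauliDistribution_mem_stdSimplex (hψ : ∑ x, ‖ψ x‖ ^ 2 = 1) :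
    pauliDistribution ψ ∈ stdSimplex ℝ (Fin n → Fin 4) := by
  refine ⟨fun P => by unfold pauliDistribution; positivity, ?_⟩
  simp only [pauliDistribution]
  rw [← Finset.mul_sum, sum_pauliExpectation_sq, sum_norm_overlap_sq, hψ, one_pow, mul_one,
    inv_mul_cancel₀ (by positivity)]

theorem abs_pauliExpectation_le_one (hψ : ∑ x, ‖ψ x‖ ^ 2 = 1) (P : Fin n → Fin 4) :
    |pauliExpectation ψ P| ≤ 1 := by
  set a := (pauliStringBits n P).1
  have shifted : ∑ x, ‖ψ (x + a)‖ ^ 2 = 1 := (Equiv.sum_comp (Equiv.addRight a) _).trans hψ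
  calc |pauliExpectation ψ P|
      ≤ ∑ x, ‖ψ (x + a)‖ * ‖ψ x‖ := by
        rw [abs_pauliExpectation]
        refine (norm_walshTransform_le _ _).trans_eq ?_
        simp only [overlap, norm_mul, RCLike.norm_conj, a]
    _ ≤ ∑ x, (‖ψ (x + a)‖ ^ 2 + ‖ψ x‖ ^ 2) / 2 :=
        Finset.sum_le_sum fun x _ => by linarith [two_mul_le_add_sq ‖ψ (x + a)‖ ‖ψ x‖]
    _ = 1 := by rw [← Finset.sum_div, Finset.sum_add_distrib, shifted, hψ, add_self_div_two]

theorem pauliDistribution_le (hψ : ∑ x, ‖ψ x‖ ^ 2 = 1) (P : Fin n → Fin 4) :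
    pauliDistribution ψ P ≤ (2 ^ n)⁻¹ :=
  mul_le_of_le_one_right (by positivity)
    ((sq_le_one_iff_abs_le_one _).2 (abs_pauliExpectation_le_one hψ P))

open scoped Pointwise in
theorem ncard_support_pauliDistribution_le {S : Finset (BitString n)} (hS : ∀ x ∉ S, ψ x = 0) :
    (Function.support (pauliDistribution ψ)).ncard ≤ S.card ^ 2 * 2 ^ n := by
  have subset : pauliStringBits n '' Function.support (pauliDistribution ψ) ⊆
      ((S + S) ×ˢ Finset.univ : Finset (BitString n × BitString n)) := by
    rintro _ ⟨P, hP, rfl⟩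
    have transform_ne_zero :
        walshTransform (overlap ψ (pauliStringBits n P).1) (pauliStringBits n P).2 ≠ 0 := by
      rw [← norm_ne_zero_iff, ← abs_pauliExpectation, abs_ne_zero]
      exact pow_ne_zero_iff two_ne_zero |>.1 (right_ne_zero_of_mul hP)
    obtain ⟨x, -, hx⟩ := Finset.exists_ne_zero_of_sum_ne_zero transform_ne_zero
    have hx := left_ne_zero_of_mul hx
    have hxS : x ∈ S := by_contra fun h => right_ne_zero_of_mul hx (hS x h)
    have hxaS : x + (pauliStringBits n P).1 ∈ S := by_contra fun h =>
      left_ne_zero_of_mul hx (by rw [hS _ h, map_zero])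
    rw [Finset.mem_coe, Finset.mem_product]
    exact ⟨Finset.mem_add.2 ⟨x, hxS, _, hxaS, BitString.add_add_cancel _ _⟩, Finset.mem_univ _⟩
  calc (Function.support (pauliDistribution ψ)).ncard
      = (pauliStringBits n '' Function.support (pauliDistribution ψ)).ncard :=
        (Set.ncard_image_of_injective _ (pauliStringBits n).injective).symm
    _ ≤ ((S + S) ×ˢ (Finset.univ : Finset (BitString n))).card :=
        (Set.ncard_le_ncard subset).trans_eq (Set.ncard_coe_finset _)
    _ ≤ S.card ^ 2 * 2 ^ n := by
        rw [Finset.card_product, Finset.card_univ, Fintype.card_fun, Fintype.card_fin,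
          Fintype.card_fin, sq]
        exact Nat.mul_le_mul_right _ Finset.card_add_le

theorem stabilizerRenyiEntropy_le (hψ : ∑ x, ‖ψ x‖ ^ 2 = 1) {S : Finset (BitString n)}
    (hS : ∀ x ∉ S, ψ x = 0) {α : ℝ} (hα : 0 ≤ α) :
    stabilizerRenyiEntropy α ψ ≤ 2 * Real.logb 2 S.card := by
  have hp := pauliDistribution_mem_stdSimplex hψ
  have support_pos : (0 : ℝ) < (Function.support (pauliDistribution ψ)).ncard :=
    powerSum_zero (pauliDistribution ψ) ▸ powerSum_pos hp 0
  have card_le : ((Function.support (pauliDistribution ψ)).ncard : ℝ) ≤ S.card ^ 2 * 2 ^ n :=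
    mod_cast ncard_support_pauliDistribution_le hS
  have hS0 : (S.card : ℝ) ^ 2 ≠ 0 := (pos_of_mul_pos_left (support_pos.trans_le card_le)
    (by positivity)).ne'
  calc stabilizerRenyiEntropy α ψ
      ≤ renyiEntropy 0 (pauliDistribution ψ) - Real.logb 2 (2 ^ n) :=
        sub_le_sub_right (renyiEntropy_antitone hp hα) _
    _ ≤ Real.logb 2 (S.card ^ 2 * 2 ^ n) - Real.logb 2 (2 ^ n) := by
        rw [renyiEntropy_zero]
        exact sub_le_sub_right (Real.logb_le_logb_of_le one_lt_two support_pos card_le) _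
    _ = 2 * Real.logb 2 S.card := by
        rw [Real.logb_mul hS0 (by positivity), Real.logb_pow, add_sub_cancel_right, Nat.cast_ofNat]

theorem stabilizerRenyiEntropy_two_le (hψ : ∑ x, ‖ψ x‖ ^ 2 = 1) (α : ℝ) :
    stabilizerRenyiEntropy 2 ψ ≤ max 1 (α - 1) * stabilizerRenyiEntropy α ψ := by
  have hp := pauliDistribution_mem_stdSimplex hψ
  rcases le_total α 2 with hα | hα
  · rw [max_eq_left (by linarith), one_mul]
    exact sub_le_sub_right (renyiEntropy_antitone hp hα) _
  · have h := renyiEntropy_two_add_le hp (pauliDistribution_le hψ) hα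
    rw [Real.logb_inv, neg_neg] at h
    rw [max_eq_right (by linarith), stabilizerRenyiEntropy, stabilizerRenyiEntropy]
    linarith

/-- The stabilizer purity `2⁻ⁿ ∑ ⟨ψ|P|ψ⟩ ^ 4`, whose logarithm is the negative of the stabilizer
Rényi entropy of order two. -/
noncomputable def stabilizerPurity (ψ : QubitVector n) : ℝ :=
  (2 ^ n)⁻¹ * ∑ P, pauliExpectation ψ P ^ 4

theorem stabilizerPurity_eq (ψ : QubitVector n) :
    stabilizerPurity ψ = 2 ^ n * ∑ P, pauliDistribution ψ P ^ 2 := by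
  simp only [stabilizerPurity, pauliDistribution, mul_pow, ← pow_mul, ← Finset.mul_sum]
  field_simp

theorem stabilizerPurity_pos (hψ : ∑ x, ‖ψ x‖ ^ 2 = 1) : 0 < stabilizerPurity ψ := by
  have h := powerSum_pos (pauliDistribution_mem_stdSimplex hψ) 2
  rw [powerSum_two] at h
  rw [stabilizerPurity_eq]
  positivity

theorem stabilizerRenyiEntropy_two (hψ : ∑ x, ‖ψ x‖ ^ 2 = 1) :
    stabilizerRenyiEntropy 2 ψ = -Real.logb 2 (stabilizerPurity ψ) := by
  have h := stabilizerPurity_pos hψ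
  rw [stabilizerPurity_eq] at h ⊢
  rw [Real.logb_mul (by positivity) (right_ne_zero_of_mul h.ne'), stabilizerRenyiEntropy,
    renyiEntropy_two, neg_add_rev, sub_eq_add_neg]

/-- The contribution of the quadruple `x, y, z, w` to the stabilizer purity: a product over the
eight points that are sums of an odd number of `x, y, z, w`. -/
def purityTerm (ψ : QubitVector n) (x y z w : BitString n) : ℂ :=
  ψ x * ψ z * ψ (x + y + w) * ψ (y + z + w) *
    conj (ψ y * ψ w * ψ (x + y + z) * ψ (x + z + w))

/-- The quadruple arises from the shifts `a = x + y` and `s = x + z` in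
`∑ₐ ∑ₛ |∑ₓ overlap ψ a x * overlap ψ a (x + s)| ^ 2`. -/
theorem ofReal_stabilizerPurity (ψ : QubitVector n) :
    (stabilizerPurity ψ : ℂ) = ∑ x, ∑ y, ∑ z, ∑ w, purityTerm ψ x y z w := by
  rw [stabilizerPurity, sum_pauliExpectation_pow_four, inv_mul_cancel_left₀ (by positivity)]
  simp only [Complex.ofReal_sum, Complex.ofReal_pow, ← Complex.mul_conj', map_sum,
    Finset.sum_mul_sum]
  rw [(Finset.sum_congr rfl fun a _ => Finset.sum_comm).trans Finset.sum_comm]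
  refine Finset.sum_congr rfl fun x _ => ?_
  rw [← Equiv.sum_comp (Equiv.addLeft x)]
  refine Finset.sum_congr rfl fun y _ => ?_
  rw [← Equiv.sum_comp (Equiv.addLeft x)]
  refine Finset.sum_congr rfl fun z _ => Finset.sum_congr rfl fun w _ => ?_
  have hxyz : z + (x + y) = x + y + z := add_comm _ _
  have hxyw : w + (x + y) = x + y + w := add_comm _ _
  have hxzw : w + (x + z) = x + z + w := add_comm _ _
  have hyzw : x + z + w + (x + y) = y + z + w := by
    rw [← BitString.add_add_cancel x (y + z + w)]
    abel
  simp only [Equiv.coe_addLeft, overlap, purityTerm, BitString.add_add_cancel, hxyz, hxyw, hxzw,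
    hyzw, map_mul, Complex.conj_conj]
  ring

theorem ofReal_stabilizerPurity_of_support {S : Finset (BitString n)} (hS : ∀ x ∉ S, ψ x = 0) :
    (stabilizerPurity ψ : ℂ) =
      ∑ x ∈ S, ∑ y ∈ S, ∑ z ∈ S, ∑ w ∈ S, purityTerm ψ x y z w := by
  have restrict {g : BitString n → ℂ} (hg : ∀ x ∉ S, g x = 0) : ∑ x, g x = ∑ x ∈ S, g x :=
    (Finset.sum_subset (Finset.subset_univ S) fun x _ => hg x).symm
  rw [ofReal_stabilizerPurity, restrict fun x hx => by simp [purityTerm, hS x hx]]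
  refine Finset.sum_congr rfl fun x _ => ?_
  rw [restrict fun y hy => by simp [purityTerm, hS y hy]]
  refine Finset.sum_congr rfl fun y _ => ?_
  rw [restrict fun z hz => by simp [purityTerm, hS z hz]]
  exact Finset.sum_congr rfl fun z _ => restrict fun w hw => by simp [purityTerm, hS w hw]

end StabilizerEntropy

section RandomPhase

theorem expect_eq_zero_of_add_right_eq_neg {A R : Type*} [AddGroup A] [Fintype A] [Field R]
    [CharZero R] {G : A → R} (a : A) (hG : ∀ f, G (f + a) = -G f) : 𝔼 f, G f = 0 := by
  rw [← self_eq_neg, ← Finset.expect_neg_distrib]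
  exact (Fintype.expect_equiv (Equiv.addRight a) _ _ fun f => (hG f).symm ▸ rfl).symm

variable {n : ℕ} (S : Finset (BitString n)) (f : BitString n → Fin 2)

theorem norm_subsetPhaseState (x : BitString n) :
    ‖subsetPhaseState S f x‖ = if x ∈ S then (√(S.card : ℝ))⁻¹ else 0 := by
  unfold subsetPhaseState
  split_ifs <;> simp [abs_of_nonneg]

theorem norm_subsetPhaseState_sq (x : BitString n) :
    ‖subsetPhaseState S f x‖ ^ 2 = if x ∈ S then (S.card : ℝ)⁻¹ else 0 := by
  rw [norm_subsetPhaseState, ite_pow, inv_pow, Real.sq_sqrt (Nat.cast_nonneg _),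
    zero_pow two_ne_zero]

theorem norm_subsetPhaseState_le (x : BitString n) :
    ‖subsetPhaseState S f x‖ ≤ (√(S.card : ℝ))⁻¹ := by
  rw [norm_subsetPhaseState]
  split_ifs
  · rfl
  · positivity

variable {S} in
theorem subsetPhaseState_of_notMem {x : BitString n} (hx : x ∉ S) : subsetPhaseState S f x = 0 :=
  if_neg hx

theorem subsetPhaseState_add_single_self (x : BitString n) :
    subsetPhaseState S (f + Pi.single x 1) x = -subsetPhaseState S f x := by
  have flip (a : Fin 2) : (-1 : ℂ) ^ ((a + 1 : Fin 2) : ℕ) = -(-1) ^ (a : ℕ) := by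
    fin_cases a <;> simp
  simp only [subsetPhaseState, Pi.add_apply, Pi.single_eq_same, flip]
  split_ifs <;> ring

variable {x y z w : BitString n}

theorem subsetPhaseState_add_single_of_ne (h : x ≠ y) :
    subsetPhaseState S (f + Pi.single x 1) y = subsetPhaseState S f y := by
  simp only [subsetPhaseState, Pi.add_apply, Pi.single_eq_of_ne h.symm, add_zero]

/-- Affine dependence over the field with two elements: two of the four points coincide or the
four points sum to zero. -/
def IsAffineDependent (x y z w : BitString n) : Prop :=
  x = y ∨ x = z ∨ x = w ∨ y = z ∨ y = w ∨ z = w ∨ x + y + z = w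

instance : Decidable (IsAffineDependent x y z w) := by
  unfold IsAffineDependent
  infer_instance

/-- For affinely independent points, `x` differs from the other seven points in the purity term, so
flipping the phase at `x` changes the sign of the term. -/
theorem expect_purityTerm_subsetPhaseState (h : ¬IsAffineDependent x y z w) :
    𝔼 f, purityTerm (subsetPhaseState S f) x y z w = 0 := by
  simp only [IsAffineDependent, not_or] at h
  obtain ⟨hxy, hxz, hxw, hyz, hyw, hzw, hsum⟩ := h
  have ne_add {u v : BitString n} (huv : u ≠ v) : x ≠ x + u + v := by
    rwa [add_assoc, ne_eq, left_eq_add, BitString.add_eq_zero_iff]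
  have hyzw : x ≠ y + z + w := fun h => hsum <| by
    rw [h, show y + z + w + y + z = y + z + (y + z + w) by abel, BitString.add_add_cancel]
  refine expect_eq_zero_of_add_right_eq_neg (Pi.single x 1) fun f => ?_
  have unchanged {u : BitString n} (hu : x ≠ u) := subsetPhaseState_add_single_of_ne S f hu
  simp only [purityTerm, subsetPhaseState_add_single_self, unchanged hxy, unchanged hxz,
    unchanged hxw, unchanged (ne_add hyz), unchanged (ne_add hyw), unchanged (ne_add hzw),
    unchanged hyzw, neg_mul]

theorem norm_purityTerm_subsetPhaseState_le :
    ‖purityTerm (subsetPhaseState S f) x y z w‖ ≤ ((S.card : ℝ) ^ 4)⁻¹ := by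
  have hsqrt : (√(S.card : ℝ))⁻¹ ^ 8 = ((S.card : ℝ) ^ 4)⁻¹ := by
    rw [inv_pow, show 8 = 2 * 4 from rfl, pow_mul, Real.sq_sqrt (Nat.cast_nonneg _)]
  calc ‖purityTerm (subsetPhaseState S f) x y z w‖
      ≤ (√(S.card : ℝ))⁻¹ * (√(S.card : ℝ))⁻¹ * (√(S.card : ℝ))⁻¹ * (√(S.card : ℝ))⁻¹ *
        ((√(S.card : ℝ))⁻¹ * (√(S.card : ℝ))⁻¹ * (√(S.card : ℝ))⁻¹ * (√(S.card : ℝ))⁻¹) := by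
        simp only [purityTerm, norm_mul, RCLike.norm_conj]
        gcongr <;> exact norm_subsetPhaseState_le S f _
    _ = ((S.card : ℝ) ^ 4)⁻¹ := by rw [← hsqrt]; ring

theorem norm_expect_purityTerm_subsetPhaseState_le :
    ‖𝔼 f, purityTerm (subsetPhaseState S f) x y z w‖ ≤
      if IsAffineDependent x y z w then ((S.card : ℝ) ^ 4)⁻¹ else 0 := by
  split_ifs with h
  · exact (RCLike.norm_expect_le (K := ℂ)).trans <| Finset.expect_le Finset.univ_nonempty fun f _ =>
      norm_purityTerm_subsetPhaseState_le S f
  · rw [expect_purityTerm_subsetPhaseState S h, norm_zero]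

theorem sum_ite_isAffineDependent_le :
    ∑ x ∈ S, ∑ y ∈ S, ∑ z ∈ S, ∑ w ∈ S, (if IsAffineDependent x y z w then 1 else 0) ≤
      7 * S.card ^ 3 := by
  have union_bound (x y z w : BitString n) : (if IsAffineDependent x y z w then 1 else 0) ≤
      (if x = y then 1 else 0) + (if x = z then 1 else 0) + (if x = w then 1 else 0) +
        (if y = z then 1 else 0) + (if y = w then 1 else 0) + (if z = w then 1 else 0) +
        if x + y + z = w then 1 else 0 := by
    unfold IsAffineDependent
    grind
  calc ∑ x ∈ S, ∑ y ∈ S, ∑ z ∈ S, ∑ w ∈ S, (if IsAffineDependent x y z w then 1 else 0)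
      ≤ ∑ x ∈ S, ∑ y ∈ S, ∑ z ∈ S, ∑ w ∈ S, ((if x = y then 1 else 0) +
        (if x = z then 1 else 0) + (if x = w then 1 else 0) + (if y = z then 1 else 0) +
        (if y = w then 1 else 0) + (if z = w then 1 else 0) +
        if x + y + z = w then 1 else 0) := by
        gcongr
        exact union_bound _ _ _ _
    _ ≤ 7 * S.card ^ 3 := by
        have sum_closing_le : ∑ x ∈ S, ∑ y ∈ S, ∑ z ∈ S, (if x + y + z ∈ S then 1 else 0) ≤
            ∑ x ∈ S, ∑ y ∈ S, ∑ z ∈ S, 1 := by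
          gcongr
          split_ifs <;> simp only [le_refl, zero_le]
        simp only [Finset.sum_const, smul_eq_mul, mul_one] at sum_closing_le
        simp only [Finset.sum_add_distrib, Finset.sum_ite_eq, Finset.sum_const, smul_eq_mul,
          apply_ite (S.card * ·), mul_one, mul_zero, Finset.sum_ite_mem, Finset.inter_self]
        linarith

theorem expect_stabilizerPurity_subsetPhaseState_le :
    𝔼 f, stabilizerPurity (subsetPhaseState S f) ≤ 7 / S.card := by
  have expect_eq : ((𝔼 f, stabilizerPurity (subsetPhaseState S f) : ℝ) : ℂ) =
      ∑ x ∈ S, ∑ y ∈ S, ∑ z ∈ S, ∑ w ∈ S, 𝔼 f, purityTerm (subsetPhaseState S f) x y z w := by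
    simp only [Complex.ofReal_expect, Finset.expect_sum_comm,
      ofReal_stabilizerPurity_of_support fun _ => subsetPhaseState_of_notMem _]
  calc 𝔼 f, stabilizerPurity (subsetPhaseState S f)
      ≤ ‖((𝔼 f, stabilizerPurity (subsetPhaseState S f) : ℝ) : ℂ)‖ := by
        rw [Complex.norm_real]
        exact le_abs_self _
    _ ≤ ∑ x ∈ S, ∑ y ∈ S, ∑ z ∈ S, ∑ w ∈ S,
          if IsAffineDependent x y z w then ((S.card : ℝ) ^ 4)⁻¹ else 0 := by
        rw [expect_eq]
        exact norm_sum_le_of_le _ fun x _ => norm_sum_le_of_le _ fun y _ =>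
          norm_sum_le_of_le _ fun z _ => norm_sum_le_of_le _ fun w _ =>
            norm_expect_purityTerm_subsetPhaseState_le S
    _ = (∑ x ∈ S, ∑ y ∈ S, ∑ z ∈ S, ∑ w ∈ S, (if IsAffineDependent x y z w then 1 else 0) : ℕ) *
          ((S.card : ℝ) ^ 4)⁻¹ := by
        push_cast
        simp only [Finset.sum_mul, ite_mul, one_mul, zero_mul]
    _ ≤ (7 * S.card ^ 3 : ℕ) * ((S.card : ℝ) ^ 4)⁻¹ := by
        gcongr
        exact sum_ite_isAffineDependent_le S
    _ = 7 / S.card := by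
        rcases S.eq_empty_or_nonempty with rfl | hS
        · simp
        · have := hS.card_ne_zero
          push_cast
          field_simp

variable {S}

theorem sum_norm_subsetPhaseState_sq (hS : S.Nonempty) :
    ∑ x, ‖subsetPhaseState S f x‖ ^ 2 = 1 := by
  have := hS.card_ne_zero
  simp [norm_subsetPhaseState_sq, this]

theorem logb_card_sub_le_expect_stabilizerRenyiEntropy (hS : S.Nonempty) :
    Real.logb 2 S.card - Real.logb 2 7 ≤
      𝔼 f, stabilizerRenyiEntropy 2 (subsetPhaseState S f) := by
  have purity_pos (f : BitString n → Fin 2) : 0 < stabilizerPurity (subsetPhaseState S f) :=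
    stabilizerPurity_pos (sum_norm_subsetPhaseState_sq f hS)
  have hcard : (S.card : ℝ) ≠ 0 := mod_cast hS.card_ne_zero
  calc Real.logb 2 S.card - Real.logb 2 7
      = -Real.logb 2 (7 / S.card) := by rw [Real.logb_div (by norm_num) hcard, neg_sub]
    _ ≤ -Real.logb 2 (𝔼 f, stabilizerPurity (subsetPhaseState S f)) :=
        neg_le_neg <| Real.logb_le_logb_of_le one_lt_two
          (Finset.expect_pos (fun f _ => purity_pos f) Finset.univ_nonempty)
          (expect_stabilizerPurity_subsetPhaseState_le S)
    _ ≤ -𝔼 f, Real.logb 2 (stabilizerPurity (subsetPhaseState S f)) :=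
        neg_le_neg <| expect_logb_le_logb_expect Finset.univ_nonempty (fun f _ => purity_pos f)
          one_lt_two
    _ = 𝔼 f, stabilizerRenyiEntropy 2 (subsetPhaseState S f) := by
        simp only [stabilizerRenyiEntropy_two (sum_norm_subsetPhaseState_sq _ hS),
          Finset.expect_neg_distrib]

theorem le_expect_stabilizerRenyiEntropy_subsetPhaseState (hS : S.Nonempty) (α : ℝ) :
    (Real.logb 2 S.card - Real.logb 2 7) / max 1 (α - 1) ≤
      𝔼 f, stabilizerRenyiEntropy α (subsetPhaseState S f) := by
  rw [div_le_iff₀' (by positivity), Finset.mul_expect]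
  exact (logb_card_sub_le_expect_stabilizerRenyiEntropy hS).trans <| Finset.expect_le_expect
    fun f _ => stabilizerRenyiEntropy_two_le (sum_norm_subsetPhaseState_sq f hS) α

theorem pureCoherence_subsetPhaseState (hS : S.Nonempty) :
    pureCoherence (subsetPhaseState S f) = Real.logb 2 S.card := by
  have logb_norm_sq (x : BitString n) : ‖subsetPhaseState S f x‖ ^ 2 *
      Real.logb 2 (‖subsetPhaseState S f x‖ ^ 2) =
        -(‖subsetPhaseState S f x‖ ^ 2 * Real.logb 2 S.card) := by
    rw [norm_subsetPhaseState_sq]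
    split_ifs
    · rw [Real.logb_inv, mul_neg]
    · simp only [zero_mul, neg_zero]
  rw [pureCoherence_eq (sum_norm_subsetPhaseState_sq f hS)]
  simp only [logb_norm_sq]
  rw [Finset.sum_neg_distrib, neg_neg, ← Finset.sum_mul, sum_norm_subsetPhaseState_sq f hS, one_mul]

end RandomPhase

section Ensemble

theorem rspExpectation_eq_expect (n K : ℕ) (F : QubitVector n → ℝ) :
    rspExpectation n K F =
      𝔼 S ∈ Finset.powersetCard K Finset.univ, 𝔼 f, F (subsetPhaseState S f) := by
  simp only [Finset.expect_eq_sum_div_card (s := Finset.powersetCard K _),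
    Fintype.expect_eq_sum_div_card, ← Finset.sum_div, div_div, rspExpectation, mul_comm]

variable {n K : ℕ} {F : QubitVector n → ℝ} {c : ℝ}

theorem powersetCard_univ_bitString_nonempty (hK : K ≤ 2 ^ n) :
    (Finset.powersetCard K (Finset.univ : Finset (BitString n))).Nonempty := by
  simpa [Finset.powersetCard_nonempty] using hK

theorem rspExpectation_le (hK : K ≤ 2 ^ n)
    (h : ∀ S : Finset (BitString n), S.card = K → 𝔼 f, F (subsetPhaseState S f) ≤ c) :
    rspExpectation n K F ≤ c := by
  rw [rspExpectation_eq_expect]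
  exact Finset.expect_le (powersetCard_univ_bitString_nonempty hK) fun S hS =>
    h S (Finset.mem_powersetCard_univ.1 hS)

theorem le_rspExpectation (hK : K ≤ 2 ^ n)
    (h : ∀ S : Finset (BitString n), S.card = K → c ≤ 𝔼 f, F (subsetPhaseState S f)) :
    c ≤ rspExpectation n K F := by
  rw [rspExpectation_eq_expect]
  exact Finset.le_expect (powersetCard_univ_bitString_nonempty hK) fun S hS =>
    h S (Finset.mem_powersetCard_univ.1 hS)

theorem rspExpectation_stabilizerRenyiEntropy_le (hK0 : 0 < K) (hK : K ≤ 2 ^ n) {α : ℝ}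
    (hα : 0 ≤ α) : rspExpectation n K (stabilizerRenyiEntropy α) ≤ 2 * Real.logb 2 K := by
  refine rspExpectation_le hK fun S hS => Finset.expect_le Finset.univ_nonempty fun f _ => ?_
  subst hS
  exact stabilizerRenyiEntropy_le (sum_norm_subsetPhaseState_sq f (Finset.card_pos.1 hK0))
    (fun _ => subsetPhaseState_of_notMem f) hα

theorem le_rspExpectation_stabilizerRenyiEntropy (hK0 : 0 < K) (hK : K ≤ 2 ^ n) (α : ℝ) :
    (Real.logb 2 K - Real.logb 2 7) / max 1 (α - 1) ≤
      rspExpectation n K (stabilizerRenyiEntropy α) := by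
  refine le_rspExpectation hK fun S hS => ?_
  subst hS
  exact le_expect_stabilizerRenyiEntropy_subsetPhaseState (Finset.card_pos.1 hK0) α

theorem rspExpectation_pureCoherence (hK0 : 0 < K) (hK : K ≤ 2 ^ n) :
    rspExpectation n K pureCoherence = Real.logb 2 K := by
  have h (S : Finset (BitString n)) (hS : S.card = K) :
      𝔼 f, pureCoherence (subsetPhaseState S f) = Real.logb 2 K := by
    subst hS
    simp only [pureCoherence_subsetPhaseState _ (Finset.card_pos.1 hK0), Fintype.expect_const]
  exact le_antisymm (rspExpectation_le hK fun S hS => (h S hS).le)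
    (le_rspExpectation hK fun S hS => (h S hS).ge)

end Ensemble

theorem logb_mem_Icc_of_rpow_le {b x u v : ℝ} (hb : 1 < b) (hu : b ^ u ≤ x) (hv : x ≤ b ^ v) :
    0 < x ∧ Real.logb b x ∈ Set.Icc u v := by
  have hx : 0 < x := (by positivity : 0 < b ^ u).trans_le hu
  exact ⟨hx, (Real.le_logb_iff_rpow_le hb hx).2 hu, (Real.logb_le_iff_le_rpow hb hx).2 hv⟩

theorem mainTheorem8 (c₁ c₂ : ℝ) (hc₁ : 0 < c₁) (hc : c₁ ≤ c₂) :
    (∀ α : ℝ, 0 ≤ α → ∃ a b R : ℝ, 0 < a ∧ 0 < b ∧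
      ∀ (n t K : ℕ) (ε : ℝ), 1 ≤ t → 0 < ε → ε ≤ 1 → K ≤ 2 ^ n →
        (2 : ℝ) ^ (c₁ * Real.logb 2 (t / ε)) ≤ K →
        (K : ℝ) ≤ (2 : ℝ) ^ (c₂ * Real.logb 2 (t / ε)) →
        rspExpectation n K (stabilizerRenyiEntropy α) ≤ b * Real.logb 2 (t / ε) ∧
        (R ≤ t / ε →
          a * Real.logb 2 (t / ε) ≤ rspExpectation n K (stabilizerRenyiEntropy α))) ∧
    (∃ d : ℝ, 0 < d ∧
      ∀ (n t K : ℕ) (ε : ℝ), 1 ≤ t → 0 < ε → ε ≤ 1 → K ≤ 2 ^ n →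
        (2 : ℝ) ^ (c₁ * Real.logb 2 (t / ε)) ≤ K →
        (K : ℝ) ≤ (2 : ℝ) ^ (c₂ * Real.logb 2 (t / ε)) →
        d * Real.logb 2 (t / ε) ≤ rspExpectation n K pureCoherence) := by
  refine ⟨fun α hα => ⟨c₁ / 2 / max 1 (α - 1), 2 * c₂, 2 ^ (2 * Real.logb 2 7 / c₁),
    by positivity, by linarith, fun n t K ε _ _ _ hK hlow hup => ?_⟩,
    c₁, hc₁, fun n t K ε _ _ _ hK hlow hup => ?_⟩
  · obtain ⟨hK0, hlow, hup⟩ := logb_mem_Icc_of_rpow_le one_lt_two hlow hup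
    refine ⟨?_, fun hR => ?_⟩
    · have h := rspExpectation_stabilizerRenyiEntropy_le (Nat.cast_pos.1 hK0) hK hα
      linarith
    · have hL : 2 * Real.logb 2 7 / c₁ ≤ Real.logb 2 (t / ε) :=
        (Real.le_logb_iff_rpow_le one_lt_two (lt_of_lt_of_le (by positivity) hR)).2 hR
      rw [div_le_iff₀' hc₁] at hL
      refine le_trans ?_ (le_rspExpectation_stabilizerRenyiEntropy (Nat.cast_pos.1 hK0) hK α)
      rw [div_mul_eq_mul_div]
      gcongr
      linarith
  · obtain ⟨hK0, hlow, -⟩ := logb_mem_Icc_of_rpow_le one_lt_two hlow hup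
    exact hlow.trans_eq (rspExpectation_pureCoherence (Nat.cast_pos.1 hK0) hK).symm
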